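/- Let $\alpha,\beta,k>0$, $T_{\rm m},L,s_r\in\mathbb R$, and let the controller parameters satisfy $c_1,c_2>0$, $\delta_1>0$, $0<\delta_2<1$. Consider the one-phase Stefan problem with actuator dynamics $$T_t=\alpha T_{xx}\ (t>0,\ 0<x<s(t)),\quad -kT_x(0,t)=q_c(t),\quad T(s(t),t)=T_{\rm m},\quad \dot s(t)=-\beta T_x(s(t),t)\quad(t>0),$$ $$s(0)=s_0,\qquad T(\cdot,0)=T_0,\qquad \dot q_c(t)=U(t),$$ with a given initial flux $q_c(0)$. Put $$h_1(t)=\sigma(t)=-\Big(\tfrac k\alpha\int_0^{s(t)}(T(x,t)-T_{\rm m})\,dx+\tfrac k\beta(s(t)-s_r)\Big),\quad h_2=q_c,\quad h_3=-q_c+c_1\sigma,\quad h(x,t)=T(x,t)-T_{\rm m},$$ $U^*(t)=-c_1h_2(t)+c_2h_3(t)$, $\mu_1=\min\{\delta_1c_1,(1-\delta_2)c_2\}$ and $\bar c_2=(1+\delta_2)c_2$. The control is $U(t)=U^*(t_j)$ for $t\in[t_j,t_{j+1})$, where $t_0=0$ and, as long as $t_j<\infty$, $$t_{j+1}=\inf\Big\{t>t_j:\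 -\delta_2c_2h_3(t)>U^*(t)-U^*(t_j)\ \text{ or }\ U^*(t)-U^*(t_j)>\mu_1h_2(t)+\delta_2c_2h_3(t)\Big\}$$ ($\inf\emptyset=\infty$: no further event; once $t_j=\infty$, all later $t_i$ are $\infty$). The signals in this rule are those of the plant with the input $U^*(t_j)$ held from $t_j$ on, over the times after $t_j$ for which that classical solution exists. Assume that $0<s_0<L$, that $T_0\in C^1([0,s_0];[T_{\rm m},\infty))$ with $T_0(s_0)=T_{\rm m}$, that $q_c(0)\ge0$, that $$s_0+\tfrac\beta\alpha\int_0^{s_0}(T_0(x)-T_{\rm m})\,dx\le s_r<L,$$ and that the gain condition $q_c(0)\le c_1\sigma(0)$ holds (that is, $c_1\ge q_c(0)/\sigma(0)$ if $\sigma(0)>0$). Let $$\tau_1=\frac{-c_1(\mu_1+c_1)+\sqrt{c_1^2(\mu_1+c_1)^2+2\mu_1(1-\delta_2)c_1^2c_2}}{(1-\delta_2)c_1^2c_2},\qquad \tau_2=\frac{-(c_1+\bar c_2)+\sqrt{(c_1+\bar c_2)^2+2\delta_2c_1\bar c_2}}{c_1\bar c_2},\qquad \tau=\min\{\tau_1,\tau_2\}.$$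 Then $\tau>0$; it depends only on $c_1,c_2,\delta_1,\delta_2$ and not on the initial condition. For every classical solution of the closed-loop system, $t_{j+1}\ge t_j+\tau$ for all $j\ge0$. In particular only finitely many events occur in any bounded time interval (no Zeno behavior), and every $t\ge0$ lies in exactly one interval $[t_j,t_{j+1})$. Moreover, at all times $t\ge0$ at which the closed-loop solution is defined (all $t\ge0$ for a global solution), $$h_1(t)\ge0,\qquad h_2(t)=q_c(t)\ge0,\qquad T(x,t)\ge T_{\rm m}\ \text{ for all } x\in(0,s(t)).$$ -/

import Mathlib

open Set

noncomputable section

namespace StefanETC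

/-- Physical constants of the one-phase Stefan model: diffusivity `α`, the constants `β` and `k`,
the melting temperature `Tm`, the length `L` of the material, and the setpoint `sr` for the
interface position. -/
structure Plant where
  α : ℝ
  β : ℝ
  k : ℝ
  Tm : ℝ
  L : ℝ
  sr : ℝ

/-- Parameters of the event-triggered controller. -/
structure Gains where
  c₁ : ℝ
  c₂ : ℝ
  δ₁ : ℝ
  δ₂ : ℝ

/-- Initial data: interface position, temperature profile, boundary heat flux. -/
structure InitialData where
  s₀ : ℝ
  T₀ : ℝ → ℝ
  q₀ : ℝ

/-- The signals of the plant: temperature `T x t`, interface position `s t` and boundary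
heat flux `q t`. Only the values at the times of existence, and for `T` only those with
`0 ≤ x ≤ s t`, are meaningful. -/
structure Trajectory where
  T : ℝ → ℝ → ℝ
  s : ℝ → ℝ
  q : ℝ → ℝ

/-! ### Control barrier functions and the nominal feedback -/

/-- `h₁(t) = σ(t) = -(k/α ∫₀^{s(t)} (T(x,t) - Tm) dx + k/β (s(t) - sr))`. -/
def h₁ (P : Plant) (z : Trajectory) (t : ℝ) : ℝ :=
  -(P.k / P.α * (∫ x in (0 : ℝ)..(z.s t), (z.T x t - P.Tm)) + P.k / P.β * (z.s t - P.sr))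

/-- `h₂(t) = q(t)`. -/
def h₂ (z : Trajectory) (t : ℝ) : ℝ := z.q t

/-- `h₃(t) = -q(t) + c₁ σ(t)`. -/
def h₃ (P : Plant) (G : Gains) (z : Trajectory) (t : ℝ) : ℝ := -z.q t + G.c₁ * h₁ P z t

/-- `h(x,t) = T(x,t) - Tm`. -/
def h (P : Plant) (z : Trajectory) (x t : ℝ) : ℝ := z.T x t - P.Tm

/-- The nonovershooting feedback `U*(t) = -c₁ h₂(t) + c₂ h₃(t)`. -/
def Ustar (P : Plant) (G : Gains) (z : Trajectory) (t : ℝ) : ℝ :=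
  -G.c₁ * h₂ z t + G.c₂ * h₃ P G z t

/-! ### Standing assumptions on the initial data -/

/-- `σ(0)` expressed through the initial data. -/
def InitialData.sigma (P : Plant) (D : InitialData) : ℝ :=
  -(P.k / P.α * (∫ x in (0 : ℝ)..D.s₀, (D.T₀ x - P.Tm)) + P.k / P.β * (D.s₀ - P.sr))

/-- `0 < s₀ < L`, `T₀ ∈ C¹([0,s₀]; [Tm,∞))` and `T₀(s₀) = Tm`. -/
def InitialData.ProfileOK (P : Plant) (D : InitialData) : Prop :=
  0 < D.s₀ ∧ D.s₀ < P.L ∧ ContDiffOn ℝ 1 D.T₀ (Icc 0 D.s₀) ∧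
    (∀ x ∈ Icc 0 D.s₀, P.Tm ≤ D.T₀ x) ∧ D.T₀ D.s₀ = P.Tm

/-- `s₀ + β/α ∫₀^{s₀} (T₀ - Tm) dx ≤ sr < L`. -/
def InitialData.SetpointOK (P : Plant) (D : InitialData) : Prop :=
  D.s₀ + P.β / P.α * (∫ x in (0 : ℝ)..D.s₀, (D.T₀ x - P.Tm)) ≤ P.sr ∧ P.sr < P.L

/-! ### Classical solutions of the Stefan problem -/

/-- The spatial derivative `T_x(x,t)` on `[0, s(t)]`; it is one-sided at the two end points. -/
def Tx (z : Trajectory) (x t : ℝ) : ℝ := derivWithin (fun y => z.T y t) (Icc 0 (z.s t)) x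

/-- The second spatial derivative `T_xx(x,t)`, used for `0 < x < s(t)`. -/
def Txx (z : Trajectory) (x t : ℝ) : ℝ := deriv (fun y => Tx z y t) x

/-- The time derivative `T_t(x,t)`, used for `0 < x < s(t)`. -/
def Tt (z : Trajectory) (x t : ℝ) : ℝ := deriv (fun r => z.T x r) t

/-- The open liquid domain `{(x,t) : 0 < t < E, 0 < x < s(t)}`. -/
def openDomain (z : Trajectory) (E : EReal) : Set (ℝ × ℝ) :=
  {p | 0 < p.2 ∧ (p.2 : EReal) < E ∧ 0 < p.1 ∧ p.1 < z.s p.2}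

/-- The domain `{(x,t) : 0 < t < E, 0 ≤ x ≤ s(t)}`. -/
def lateralDomain (z : Trajectory) (E : EReal) : Set (ℝ × ℝ) :=
  {p | 0 < p.2 ∧ (p.2 : EReal) < E ∧ 0 ≤ p.1 ∧ p.1 ≤ z.s p.2}

/-- The domain `{(x,t) : 0 ≤ t < E, 0 ≤ x ≤ s(t)}`. -/
def closedDomain (z : Trajectory) (E : EReal) : Set (ℝ × ℝ) :=
  {p | 0 ≤ p.2 ∧ (p.2 : EReal) < E ∧ 0 ≤ p.1 ∧ p.1 ≤ z.s p.2}

/-- `(T, s)` is a classical solution, on the time interval `[0, E)` with `E ≤ ∞`, of the one-phase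
Stefan problem driven by the boundary heat flux `q` and started from `(T₀, s₀)`. -/
structure IsClassicalSolution (P : Plant) (D : InitialData) (z : Trajectory) (E : EReal) :
    Prop where
  /-- the liquid phase does not vanish during the lifetime of the solution -/
  s_pos : ∀ t : ℝ, 0 ≤ t → (t : EReal) < E → 0 < z.s t
  s_cont : ContinuousOn z.s {t : ℝ | 0 ≤ t ∧ (t : EReal) < E}
  T_cont : ContinuousOn (fun p : ℝ × ℝ => z.T p.1 p.2) (closedDomain z E)
  T_diff_x : ∀ p ∈ lateralDomain z E,
    DifferentiableWithinAt ℝ (fun y => z.T y p.2) (Icc 0 (z.s p.2)) p.1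
  Tx_cont : ContinuousOn (fun p : ℝ × ℝ => Tx z p.1 p.2) (lateralDomain z E)
  T_diff_t : ∀ p ∈ openDomain z E, DifferentiableAt ℝ (fun r => z.T p.1 r) p.2
  Tt_cont : ContinuousOn (fun p : ℝ × ℝ => Tt z p.1 p.2) (openDomain z E)
  Tx_diff_x : ∀ p ∈ openDomain z E, DifferentiableAt ℝ (fun y => Tx z y p.2) p.1
  Txx_cont : ContinuousOn (fun p : ℝ × ℝ => Txx z p.1 p.2) (openDomain z E)
  /-- heat equation -/
  heat : ∀ p ∈ openDomain z E, Tt z p.1 p.2 = P.α * Txx z p.1 p.2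
  /-- heat flux at the fixed boundary -/
  flux : ∀ t : ℝ, 0 < t → (t : EReal) < E → -P.k * Tx z 0 t = z.q t
  /-- melting temperature at the interface -/
  melt : ∀ t : ℝ, 0 < t → (t : EReal) < E → z.T (z.s t) t = P.Tm
  /-- interface dynamics -/
  interface : ∀ t : ℝ, 0 < t → (t : EReal) < E → HasDerivAt z.s (-P.β * Tx z (z.s t) t) t
  s_init : z.s 0 = D.s₀
  T_init : ∀ x ∈ Ioc 0 D.s₀, z.T x 0 = D.T₀ x

/-! ### The event-triggered closed loop -/

/-- `μ₁ = min {δ₁ c₁, (1 - δ₂) c₂}`. -/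
def Gains.mu₁ (G : Gains) : ℝ := min (G.δ₁ * G.c₁) ((1 - G.δ₂) * G.c₂)

/-- `c̄₂ = (1 + δ₂) c₂`. -/
def Gains.cbar₂ (G : Gains) : ℝ := (1 + G.δ₂) * G.c₂

/-- The condition on the time `t` that calls for a new event, when `a` is the last event time:
with `Ũ*(t) = U*(t) - U*(a)`, either `-δ₂ c₂ h₃(t) > Ũ*(t)` or
`Ũ*(t) > μ₁ h₂(t) + δ₂ c₂ h₃(t)`. -/
def Violates (P : Plant) (G : Gains) (z : Trajectory) (a t : ℝ) : Prop :=
  -G.δ₂ * G.c₂ * h₃ P G z t > Ustar P G z t - Ustar P G z a ∨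
    Ustar P G z t - Ustar P G z a > G.mu₁ * h₂ z t + G.δ₂ * G.c₂ * h₃ P G z t

/-- The data of an execution of the sampled closed loop: the event times `t₀, t₁, …` (with the
value `⊤` from the moment on when no further event occurs) and, for each `j`, the trajectory of
the plant from time `0` on when the samples taken at `t₀, …, t_j` are applied and the last one is
held, with its time interval of existence `[0, life j)`. -/
structure Execution where
  time : ℕ → EReal
  traj : ℕ → Trajectory
  life : ℕ → EReal

/-- The execution obeys the plant equations, the actuator dynamics `q̇ = U`, the zero-order hold
`U(t) = U*(t_j)` and the triggering rule. The `j`-th trajectory is the one on which the trigger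
looks for the event `t_{j+1}`; at `t_{j+1}` the closed loop passes to the next trajectory, which
has the same past. The lifetimes are arbitrary; global executions have
`life j = ⊤` for the last `j` with `t_j < ⊤`, if there is a last one. -/
structure IsClosedLoop (P : Plant) (G : Gains) (D : InitialData) (e : Execution) : Prop where
  time_zero : e.time 0 = 0
  /-- the solution with the newly held input exists at least for a short while -/
  alive : ∀ j, e.time j ≠ ⊤ → e.time j < e.life j
  plant : ∀ j, e.time j ≠ ⊤ → IsClassicalSolution P D (e.traj j) (e.life j)
  flux_init : (e.traj 0).q 0 = D.q₀
  flux_cont : ∀ j, e.time j ≠ ⊤ →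
    ContinuousOn (e.traj j).q {t : ℝ | 0 ≤ t ∧ (t : EReal) < e.life j}
  /-- `q̇(t) = U*(t_j)`, as a right derivative at `t = t_j` -/
  hold : ∀ j, ∀ t : ℝ, e.time j ≤ t → (t : EReal) < e.life j →
    HasDerivWithinAt (e.traj j).q (Ustar P G (e.traj j) (e.time j).toReal) (Ici t) t
  /-- the infimum is `⊤` if the triggering condition is never met -/
  trigger : ∀ j, e.time (j + 1) = sInf ((fun t : ℝ => (t : EReal)) ''
    {t : ℝ | e.time j < t ∧ (t : EReal) < e.life j ∧
      Violates P G (e.traj j) (e.time j).toReal t})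
  /-- up to `t_{j+1}` the next trajectory is the old one -/
  same_past : ∀ j, e.time (j + 1) ≠ ⊤ → ∀ t : ℝ, 0 ≤ t → (t : EReal) ≤ e.time (j + 1) →
    (e.traj (j + 1)).s t = (e.traj j).s t ∧ (e.traj (j + 1)).q t = (e.traj j).q t ∧
      ∀ x ∈ Icc 0 ((e.traj j).s t), (e.traj (j + 1)).T x t = (e.traj j).T x t

/-- `t ∈ [t_j, t_{j+1})`: at time `t` the closed loop runs along the `j`-th trajectory. -/
def Execution.Active (e : Execution) (j : ℕ) (t : ℝ) : Prop :=
  e.time j ≤ t ∧ (t : EReal) < e.time (j + 1)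

/-! ### The dwell time -/

def Gains.tau₁ (G : Gains) : ℝ :=
  (-(G.c₁ * (G.mu₁ + G.c₁)) +
      √(G.c₁ ^ 2 * (G.mu₁ + G.c₁) ^ 2 + 2 * G.mu₁ * (1 - G.δ₂) * G.c₁ ^ 2 * G.c₂)) /
    ((1 - G.δ₂) * G.c₁ ^ 2 * G.c₂)

def Gains.tau₂ (G : Gains) : ℝ :=
  (-(G.c₁ + G.cbar₂) + √((G.c₁ + G.cbar₂) ^ 2 + 2 * G.δ₂ * G.c₁ * G.cbar₂)) /
    (G.c₁ * G.cbar₂)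

/-- `τ = min {τ₁, τ₂}`. -/
def Gains.tau (G : Gains) : ℝ := min G.tau₁ G.tau₂

end StefanETC

end

namespace StefanETC

/-! The heat balance gives `σ' = -q`: melting and storage absorb exactly the flux through `x = 0`.
Hence, while the input `U*(t_j)` is held, `q` is affine and `σ` quadratic in `r = t - t_j`
(`IsHeld.q_eq`, `IsHeld.h₁_eq`), and the PDE drops out of the event rule. In terms of `A = h₂(t_j)`
and `B = h₃(t_j)`, the slack in each trigger inequality is a linear form in `A`, `B` whose
coefficients are polynomials in `r`. One coefficient is visibly nonnegative; the other is, up to a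
positive factor, a quadratic with positive root `τ₂` (first inequality) or `τ₁` (second). So `A, B ≥
0` excludes events before `τ` has elapsed (`IsHeld.not_violates`).

Conversely, as long as no event is due, the trigger inequalities say `h₃' ≥ -c̄₂ h₃` and, once `h₃ ≥
0`, `q' ≥ -(c₁ + μ₁) q`; both signs persist up to the next event (`IsHeld.barrier_nonneg`).
Induction over events closes the loop, the gain condition being `h₃(0) ≥ 0`. Finally `c₁ h₁ = h₂ +
h₃`, and `T ≥ Tm` follows from `q ≥ 0` by the minimum principle
`IsClassicalSolution.le_T_of_flux_nonneg`. -/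

open MeasureTheory Filter Topology

/-! ### Integrals depending on a parameter -/

/-- Continuity of a parametric integral over a fixed interval, on compact parameter intervals. -/
theorem continuousOn_parametric_intervalIntegral {v : ℝ → ℝ → ℝ} {a b : ℝ} (hab : a ≤ b)
    (hv : ContinuousOn (fun p : ℝ × ℝ => v p.1 p.2) (Icc 0 1 ×ˢ Icc a b)) :
    ContinuousOn (fun t => ∫ y in (0 : ℝ)..1, v y t) (Icc a b) := by
  -- Clamping both variables to their intervals gives a globally continuous integrand.
  have hc : Continuous (fun p : ℝ × ℝ =>
      v (projIcc 0 1 zero_le_one p.2) (projIcc a b hab p.1)) :=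
    hv.comp_continuous (f := fun p : ℝ × ℝ =>
      (((projIcc 0 1 zero_le_one p.2 : Icc (0 : ℝ) 1) : ℝ), ((projIcc a b hab p.1 : Icc a b) : ℝ)))
      (by fun_prop) (fun p => ⟨Subtype.coe_prop _, Subtype.coe_prop _⟩)
  have h1 := intervalIntegral.continuous_parametric_intervalIntegral_of_continuous' (μ := volume)
    (f := fun t y => v (projIcc 0 1 zero_le_one y) (projIcc a b hab t)) hc 0 1
  refine h1.continuousOn.congr fun t ht => ?_
  refine intervalIntegral.integral_congr fun y hy => ?_
  rw [uIcc_of_le zero_le_one] at hy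
  simp only [projIcc_of_mem _ ht, projIcc_of_mem _ hy]

/-- Differentiation under the integral sign, for a continuous integrand with continuous
derivative in the parameter. -/
theorem hasDerivAt_integral_of_continuousOn {w w' : ℝ → ℝ → ℝ} {c d a b : ℝ} (hcd : c ≤ d)
    (hw : ContinuousOn (fun p : ℝ × ℝ => w p.1 p.2) (Icc c d ×ˢ Icc a b))
    (hw' : ContinuousOn (fun p : ℝ × ℝ => w' p.1 p.2) (Icc c d ×ˢ Icc a b))
    (hd : ∀ y ∈ Icc c d, ∀ t ∈ Icc a b, HasDerivAt (fun r => w y r) (w' y t) t)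
    {t : ℝ} (ht : t ∈ Ioo a b) :
    HasDerivAt (fun r => ∫ y in c..d, w y r) (∫ y in c..d, w' y t) t := by
  have slice : ∀ {f : ℝ → ℝ → ℝ}, ContinuousOn (fun p : ℝ × ℝ => f p.1 p.2) (Icc c d ×ˢ Icc a b) →
      ∀ r ∈ Icc a b, ContinuousOn (fun y => f y r) (uIcc c d) := fun {f} hf r hr => by
    rw [uIcc_of_le hcd]
    exact hf.comp (f := fun y : ℝ => (y, r)) (by fun_prop) (fun y hy => ⟨hy, hr⟩)
  obtain ⟨C, hC⟩ := (isCompact_Icc.prod isCompact_Icc).exists_bound_of_continuousOn hw'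
  have hsub : uIoc c d ⊆ Icc c d := by
    rw [uIoc_of_le hcd]; exact Ioc_subset_Icc_self
  refine (intervalIntegral.hasDerivAt_integral_of_dominated_loc_of_deriv_le (μ := volume)
    (F := fun r y => w y r) (F' := fun r y => w' y r) (bound := fun _ => C)
    (Icc_mem_nhds ht.1 ht.2) ?_ ?_ ?_ ?_ ?_ ?_).2
  · filter_upwards [Icc_mem_nhds ht.1 ht.2] with r hr
    exact ((slice hw r hr).intervalIntegrable).aestronglyMeasurable_restrict_uIoc
  · exact (slice hw t (Ioo_subset_Icc_self ht)).intervalIntegrable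
  · exact ((slice hw' t (Ioo_subset_Icc_self ht)).intervalIntegrable).aestronglyMeasurable_restrict_uIoc
  · exact Eventually.of_forall fun y hy r hr => hC (y, r) ⟨hsub hy, hr⟩
  · exact intervalIntegrable_const
  · exact Eventually.of_forall fun y hy r hr => hd y (hsub hy) r hr

/-- Integrated form of the conservation law `∂ₜ w = ∂_y g` on a strip, where the common value
need not extend continuously to the lateral boundary. -/
theorem hasDerivAt_integral_of_conservation {w g w' : ℝ → ℝ → ℝ} {a b : ℝ}
    (hw : ContinuousOn (fun p : ℝ × ℝ => w p.1 p.2) (Icc 0 1 ×ˢ Icc a b))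
    (hg : ContinuousOn (fun p : ℝ × ℝ => g p.1 p.2) (Icc 0 1 ×ˢ Icc a b))
    (hw' : ContinuousOn (fun p : ℝ × ℝ => w' p.1 p.2) (Ioo 0 1 ×ˢ Icc a b))
    (hwt : ∀ y ∈ Ioo (0 : ℝ) 1, ∀ t ∈ Icc a b, HasDerivAt (fun r => w y r) (w' y t) t)
    (hgy : ∀ y ∈ Ioo (0 : ℝ) 1, ∀ t ∈ Icc a b, HasDerivAt (fun x => g x t) (w' y t) y)
    {t : ℝ} (ht : t ∈ Ioo a b) :
    HasDerivAt (fun r => ∫ y in (0 : ℝ)..1, w y r) (g 1 t - g 0 t) t := by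
  -- Since `w'` may blow up at `y = 0, 1`, the law is integrated over `[ε, 1 - ε]`. The resulting
  -- derivatives converge uniformly in time because `g` is uniformly continuous on the closed strip,
  -- so the limit may be differentiated.
  have hε : ∀ᶠ ε : ℝ in 𝓝[>] 0, 0 < ε ∧ ε < 1 / 2 := by
    filter_upwards [Ioo_mem_nhdsGT (show (0 : ℝ) < 1 / 2 by norm_num)] with ε hε using hε
  have hstep : ∀ᶠ ε : ℝ in 𝓝[>] 0, ∀ r ∈ Ioo a b,
      HasDerivAt (fun r => ∫ y in ε..(1 - ε), w y r) (g (1 - ε) r - g ε r) r := by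
    filter_upwards [hε] with ε hε r hr
    have hle : ε ≤ 1 - ε := by linarith [hε.2]
    have hs : Icc ε (1 - ε) ⊆ Ioo 0 1 := fun y hy =>
      ⟨hε.1.trans_le hy.1, by linarith [hy.2, hε.1]⟩
    have hs' : Icc ε (1 - ε) ⊆ Icc 0 1 := hs.trans Ioo_subset_Icc_self
    have hwc := hw'.mono (prod_mono hs (Subset.refl (Icc a b)))
    have h1 := hasDerivAt_integral_of_continuousOn hle
      (hw.mono (prod_mono hs' (Subset.refl (Icc a b)))) hwc
      (fun y hy r hr => hwt y (hs hy) r hr) hr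
    rwa [intervalIntegral.integral_eq_sub_of_hasDerivAt (f := fun y => g y r)] at h1
    · intro y hy
      rw [uIcc_of_le hle] at hy
      exact hgy y (hs hy) r (Ioo_subset_Icc_self hr)
    · refine ContinuousOn.intervalIntegrable ?_
      rw [uIcc_of_le hle]
      exact hwc.comp (f := fun y : ℝ => (y, r)) (by fun_prop)
        (fun y hy => ⟨hy, Ioo_subset_Icc_self hr⟩)
  have huc := (isCompact_Icc.prod isCompact_Icc).uniformContinuousOn_of_continuous hg
  have hid : Tendsto (fun ε : ℝ => ε) (𝓝[>] 0) (𝓝[Icc 0 1] 0) :=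
    tendsto_nhdsWithin_iff.2 ⟨tendsto_id.mono_left nhdsWithin_le_nhds, by
      filter_upwards [hε] with ε hε using ⟨hε.1.le, by linarith [hε.2]⟩⟩
  have hid' : Tendsto (fun ε : ℝ => 1 - ε) (𝓝[>] 0) (𝓝[Icc 0 1] 1) :=
    tendsto_nhdsWithin_iff.2 ⟨by
      have : Tendsto (fun ε : ℝ => 1 - ε) (𝓝 0) (𝓝 (1 - 0)) :=
        (continuous_const.sub continuous_id).tendsto 0
      rw [sub_zero] at this
      exact this.mono_left nhdsWithin_le_nhds, by
      filter_upwards [hε] with ε hε using ⟨by linarith [hε.2], by linarith [hε.1]⟩⟩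
  have hU0 : TendstoUniformlyOn (fun ε r => g ε r) (g 0) (𝓝[>] 0) (Icc a b) := fun u hu =>
    hid.eventually ((UniformContinuousOn.tendstoUniformlyOn (F := g) huc ⟨le_rfl, zero_le_one⟩) u hu)
  have hU1 : TendstoUniformlyOn (fun ε r => g (1 - ε) r) (g 1) (𝓝[>] 0) (Icc a b) := fun u hu =>
    hid'.eventually ((UniformContinuousOn.tendstoUniformlyOn (F := g) huc ⟨zero_le_one, le_rfl⟩) u hu)
  refine hasDerivAt_of_tendstoUniformlyOn isOpen_Ioo (g' := fun r => g 1 r - g 0 r)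
    ((hU1.sub hU0).mono Ioo_subset_Icc_self) hstep (fun r hr => ?_) ht
  have hslice : ContinuousOn (fun y => w y r) (Icc 0 1) :=
    hw.comp (f := fun y : ℝ => (y, r)) (by fun_prop)
      (fun y hy => ⟨hy, Ioo_subset_Icc_self hr⟩)
  have hint : IntegrableOn (fun y => w y r) (uIcc 0 1) := by
    rw [uIcc_of_le zero_le_one]; exact hslice.integrableOn_Icc
  have hP := intervalIntegral.continuousOn_primitive_interval hint
  rw [uIcc_of_le zero_le_one] at hP
  have hsplit : (fun ε : ℝ => (∫ y in (0 : ℝ)..(1 - ε), w y r) - ∫ y in (0 : ℝ)..ε, w y r)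
      =ᶠ[𝓝[>] 0] fun ε => ∫ y in ε..(1 - ε), w y r := by
    filter_upwards [hε] with ε hε
    have hII : ∀ c ∈ Icc (0 : ℝ) 1, IntervalIntegrable (fun y => w y r) volume 0 c := fun c hc =>
      (hslice.mono (by rw [uIcc_of_le hc.1]; exact Icc_subset_Icc_right hc.2)).intervalIntegrable
    exact intervalIntegral.integral_interval_sub_left
      (hII _ ⟨by linarith [hε.2], by linarith [hε.1]⟩) (hII _ ⟨hε.1.le, by linarith [hε.2]⟩)
  refine Tendsto.congr' hsplit ?_
  have h1 := ((hP 1 ⟨zero_le_one, le_rfl⟩).tendsto.comp hid').sub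
    ((hP 0 ⟨le_rfl, zero_le_one⟩).tendsto.comp hid)
  simpa using h1

/-! ### Heat balance of a classical solution -/

namespace IsClassicalSolution

variable {P : Plant} {D : InitialData} {z : Trajectory} {E : EReal}

theorem openDomain_mem_nhds (hz : IsClassicalSolution P D z E) {p : ℝ × ℝ}
    (hp : p ∈ openDomain z E) : openDomain z E ∈ 𝓝 p := by
  obtain ⟨h0, hE, hx, hxs⟩ := hp
  have hs : ContinuousAt (fun q : ℝ × ℝ => z.s q.2) p :=
    ((hz.interface p.2 h0 hE).continuousAt).comp (f := fun q : ℝ × ℝ => q.2) continuousAt_snd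
  filter_upwards [continuousAt_snd.eventually (lt_mem_nhds h0),
    (continuous_coe_real_ereal.continuousAt.comp (f := fun q : ℝ × ℝ => q.2)
      continuousAt_snd).eventually (gt_mem_nhds hE),
    continuousAt_fst.eventually (lt_mem_nhds hx),
    continuousAt_fst.eventually_lt hs hxs] with q h1 h2 h3 h4 using ⟨h1, h2, h3, h4⟩

theorem hasDerivAt_T_x (hz : IsClassicalSolution P D z E) {p : ℝ × ℝ}
    (hp : p ∈ openDomain z E) : HasDerivAt (fun y => z.T y p.2) (Tx z p.1 p.2) p.1 :=
  (hz.T_diff_x p ⟨hp.1, hp.2.1, hp.2.2.1.le, hp.2.2.2.le⟩).hasDerivWithinAt.hasDerivAt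
    (Icc_mem_nhds hp.2.2.1 hp.2.2.2)

theorem openDomain_subset_lateralDomain : openDomain z E ⊆ lateralDomain z E :=
  fun _ hp => ⟨hp.1, hp.2.1, hp.2.2.1.le, hp.2.2.2.le⟩

/-- Continuous partial derivatives give joint differentiability, which the chain rule along the
moving point `(s(r) y, r)` requires. -/
theorem hasFDerivAt_T (hz : IsClassicalSolution P D z E) {p : ℝ × ℝ}
    (hp : p ∈ openDomain z E) :
    HasFDerivAt (fun q : ℝ × ℝ => z.T q.1 q.2)
      ((ContinuousLinearMap.toSpanSingleton ℝ (Tx z p.1 p.2)).coprod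
        (ContinuousLinearMap.toSpanSingleton ℝ (Tt z p.1 p.2))) p := by
  have hn := hz.openDomain_mem_nhds hp
  have hcont : Continuous fun c : ℝ => ContinuousLinearMap.toSpanSingleton ℝ c :=
    (ContinuousLinearMap.toSpanSingletonCLE (𝕜 := ℝ) (E := ℝ)).continuous
  refine (hasStrictFDerivAt_uncurry_coprod (𝕜 := ℝ) (u := p) (f := z.T)
    (f₁ := fun x t => ContinuousLinearMap.toSpanSingleton ℝ (Tx z x t))
    (f₂ := fun x t => ContinuousLinearMap.toSpanSingleton ℝ (Tt z x t)) ?_ ?_ ?_ ?_).hasFDerivAt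
  · filter_upwards [hn] with q hq using (hz.hasDerivAt_T_x hq).hasFDerivAt
  · filter_upwards [hn] with q hq using (hz.T_diff_t q hq).hasDerivAt.hasFDerivAt
  · exact hcont.continuousAt.comp (f := fun q : ℝ × ℝ => Tx z q.1 q.2)
      ((hz.Tx_cont.mono openDomain_subset_lateralDomain).continuousAt hn)
  · exact hcont.continuousAt.comp (f := fun q : ℝ × ℝ => Tt z q.1 q.2)
      (hz.Tt_cont.continuousAt hn)

/-- The substitution `x = s(t) y` freezes the moving boundary. -/
theorem integral_eq_scaled (z : Trajectory) (c t : ℝ) :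
    ∫ x in (0 : ℝ)..(z.s t), (z.T x t - c) = ∫ y in (0 : ℝ)..1, z.s t * (z.T (z.s t * y) t - c) := by
  rw [intervalIntegral.integral_const_mul,
    intervalIntegral.mul_integral_comp_mul_left (f := fun x => z.T x t - c)]
  simp

theorem continuousOn_scaled (hz : IsClassicalSolution P D z E) {a b : ℝ} (ha : 0 ≤ a)
    (hb : (b : EReal) < E) :
    ContinuousOn (fun p : ℝ × ℝ => z.s p.2 * (z.T (z.s p.2 * p.1) p.2 - P.Tm))
      (Icc 0 1 ×ˢ Icc a b) := by
  have hE : ∀ r ∈ Icc a b, (r : EReal) < E := fun r hr =>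
    lt_of_le_of_lt (EReal.coe_le_coe_iff.2 hr.2) hb
  have hs : ContinuousOn (fun p : ℝ × ℝ => z.s p.2) (Icc 0 1 ×ˢ Icc a b) :=
    hz.s_cont.comp (f := fun p : ℝ × ℝ => p.2) (by fun_prop)
      (fun p hp => ⟨ha.trans hp.2.1, hE _ hp.2⟩)
  refine hs.mul (ContinuousOn.sub ?_ continuousOn_const)
  refine hz.T_cont.comp (f := fun p : ℝ × ℝ => (z.s p.2 * p.1, p.2))
    ((hs.mul continuousOn_fst).prodMk continuousOn_snd) (fun p hp => ?_)
  have hsp := hz.s_pos p.2 (ha.trans hp.2.1) (hE _ hp.2)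
  exact ⟨ha.trans hp.2.1, hE _ hp.2, mul_nonneg hsp.le hp.1.1,
    mul_le_of_le_one_right hsp.le hp.1.2⟩

/-- Heat balance of the liquid phase. -/
theorem hasDerivAt_heat (hz : IsClassicalSolution P D z E) {t : ℝ} (ht : 0 < t)
    (htE : (t : EReal) < E) :
    HasDerivAt (fun r => ∫ x in (0 : ℝ)..(z.s r), (z.T x r - P.Tm))
      (P.α * (Tx z (z.s t) t - Tx z 0 t)) t := by
  obtain ⟨b, htb, hbE⟩ := EReal.lt_iff_exists_real_btwn.1 htE
  rw [EReal.coe_lt_coe_iff] at htb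
  -- The time window stays away from `0`, where no continuity of `Tx` is assumed.
  set a := t / 2 with ha_def
  have ha : 0 < a := by positivity
  have hat : a < t := by linarith
  have hE : ∀ r ∈ Icc a b, (r : EReal) < E := fun r hr =>
    lt_of_le_of_lt (EReal.coe_le_coe_iff.2 hr.2) hbE
  have hpos : ∀ r ∈ Icc a b, 0 < r := fun r hr => ha.trans_le hr.1
  have hspos : ∀ r ∈ Icc a b, 0 < z.s r := fun r hr => hz.s_pos r (hpos r hr).le (hE r hr)
  have hs : ContinuousOn (fun p : ℝ × ℝ => z.s p.2) (Icc 0 1 ×ˢ Icc a b) :=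
    hz.s_cont.comp (f := fun p : ℝ × ℝ => p.2) (by fun_prop)
      (fun p hp => ⟨(hpos _ hp.2).le, hE _ hp.2⟩)
  have hφ : ContinuousOn (fun p : ℝ × ℝ => (z.s p.2 * p.1, p.2)) (Icc 0 1 ×ˢ Icc a b) :=
    (hs.mul continuousOn_fst).prodMk continuousOn_snd
  have hφl : MapsTo (fun p : ℝ × ℝ => (z.s p.2 * p.1, p.2)) (Icc 0 1 ×ˢ Icc a b)
      (lateralDomain z E) := fun p hp =>
    ⟨hpos _ hp.2, hE _ hp.2, mul_nonneg (hspos _ hp.2).le hp.1.1,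
      mul_le_of_le_one_right (hspos _ hp.2).le hp.1.2⟩
  have hφo : MapsTo (fun p : ℝ × ℝ => (z.s p.2 * p.1, p.2)) (Ioo 0 1 ×ˢ Icc a b)
      (openDomain z E) := fun p hp =>
    ⟨hpos _ hp.2, hE _ hp.2, mul_pos (hspos _ hp.2) hp.1.1,
      mul_lt_of_lt_one_right (hspos _ hp.2) hp.1.2⟩
  have hsub : Ioo (0 : ℝ) 1 ×ˢ Icc a b ⊆ Icc 0 1 ×ˢ Icc a b :=
    prod_mono Ioo_subset_Icc_self Subset.rfl
  have hsdot : ContinuousOn (fun p : ℝ × ℝ => -P.β * Tx z (z.s p.2) p.2) (Icc 0 1 ×ˢ Icc a b) :=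
    continuousOn_const.mul <| hz.Tx_cont.comp (f := fun p : ℝ × ℝ => (z.s p.2, p.2))
      (hs.prodMk continuousOn_snd)
      (fun p hp => ⟨hpos _ hp.2, hE _ hp.2, (hspos _ hp.2).le, le_rfl⟩)
  have hlc : lateralDomain z E ⊆ closedDomain z E := fun p hp => ⟨hp.1.le, hp.2⟩
  have hTφ : ContinuousOn (fun p : ℝ × ℝ => z.T (z.s p.2 * p.1) p.2) (Icc 0 1 ×ˢ Icc a b) :=
    hz.T_cont.comp (f := fun p : ℝ × ℝ => (z.s p.2 * p.1, p.2)) hφ (fun p hp => hlc (hφl hp))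
  have hTxφ : ContinuousOn (fun p : ℝ × ℝ => Tx z (z.s p.2 * p.1) p.2) (Icc 0 1 ×ˢ Icc a b) :=
    hz.Tx_cont.comp (f := fun p : ℝ × ℝ => (z.s p.2 * p.1, p.2)) hφ hφl
  have hTxxφ : ContinuousOn (fun p : ℝ × ℝ => Txx z (z.s p.2 * p.1) p.2)
      (Ioo 0 1 ×ˢ Icc a b) :=
    hz.Txx_cont.comp (f := fun p : ℝ × ℝ => (z.s p.2 * p.1, p.2)) (hφ.mono hsub) hφo
  -- In the variable `y = x / s`, the heat equation reads `∂ᵣ[s (T - Tm)] = ∂_y[s' y (T - Tm) + α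
  -- T_x]`. The term with `s'` vanishes at `y = 0`, and at `y = 1` by the melting condition.
  have key := hasDerivAt_integral_of_conservation (a := a) (b := b)
    (w := fun y r => z.s r * (z.T (z.s r * y) r - P.Tm))
    (g := fun y r => (-P.β * Tx z (z.s r) r) * (y * (z.T (z.s r * y) r - P.Tm)) +
      P.α * Tx z (z.s r * y) r)
    (w' := fun y r => (-P.β * Tx z (z.s r) r) * ((z.T (z.s r * y) r - P.Tm) +
      y * (z.s r * Tx z (z.s r * y) r)) + P.α * (z.s r * Txx z (z.s r * y) r))
    (hz.continuousOn_scaled ha.le hbE)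
    ((hsdot.mul (continuousOn_fst.mul (hTφ.sub continuousOn_const))).add
      (continuousOn_const.mul hTxφ))
    (((hsdot.mono hsub).mul (((hTφ.mono hsub).sub continuousOn_const).add
      (continuousOn_fst.mul ((hs.mono hsub).mul (hTxφ.mono hsub))))).add
      (continuousOn_const.mul ((hs.mono hsub).mul hTxxφ)))
    ?_ ?_ ⟨hat, htb⟩
  · simp only [integral_eq_scaled]
    convert key using 1
    simp only [mul_one, mul_zero, zero_mul, hz.melt t ht htE]
    ring
  · intro y hy r hr
    have hp : (z.s r * y, r) ∈ openDomain z E := hφo (show (y, r) ∈ _ from ⟨hy, hr⟩)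
    have hsr := hz.interface r (hpos r hr) (hE r hr)
    have h1 := (hz.hasFDerivAt_T hp).comp_hasDerivAt (f := fun r => (z.s r * y, r)) r
      ((hsr.mul_const y).prodMk (hasDerivAt_id r))
    have h2 := hsr.mul (h1.sub_const P.Tm)
    refine h2.congr_deriv ?_
    have hh := hz.heat _ hp
    simp only [ContinuousLinearMap.coprod_apply, ContinuousLinearMap.toSpanSingleton_apply,
      smul_eq_mul, Function.comp_apply] at hh ⊢
    rw [hh]
    ring
  · intro y hy r hr
    have hp : (z.s r * y, r) ∈ openDomain z E := hφo (show (y, r) ∈ _ from ⟨hy, hr⟩)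
    have hlin : HasDerivAt (fun x : ℝ => z.s r * x) (z.s r) y := by
      simpa using (hasDerivAt_id y).const_mul (z.s r)
    have h1 := HasDerivAt.comp y (h₂ := fun x => z.T x r) (h := fun x => z.s r * x)
      (hz.hasDerivAt_T_x hp) hlin
    have h2 := HasDerivAt.comp y (h₂ := fun x => Tx z x r) (h := fun x => z.s r * x)
      (hz.Tx_diff_x _ hp).hasDerivAt hlin
    have h3 := (((hasDerivAt_id y).mul (h1.sub_const P.Tm)).const_mul
      (-P.β * Tx z (z.s r) r)).add (h2.const_mul P.α)
    refine h3.congr_deriv ?_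
    simp only [Function.comp_apply, id, Txx]
    ring

/-- The stored energy deficit decreases at the rate of the boundary heat flux. -/
theorem hasDerivAt_h₁ (hz : IsClassicalSolution P D z E) (hα : 0 < P.α) (hβ : 0 < P.β)
    (hk : 0 < P.k) {t : ℝ} (ht : 0 < t) (htE : (t : EReal) < E) :
    HasDerivAt (h₁ P z) (-z.q t) t := by
  have h := (((hz.hasDerivAt_heat ht htE).const_mul (P.k / P.α)).add
    (((hz.interface t ht htE).sub_const P.sr).const_mul (P.k / P.β))).neg
  refine h.congr_deriv ?_
  rw [← hz.flux t ht htE]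
  field_simp
  ring

theorem continuousOn_h₁ (hz : IsClassicalSolution P D z E) {b : ℝ} (hb : 0 ≤ b)
    (hbE : (b : EReal) < E) : ContinuousOn (h₁ P z) (Icc 0 b) := by
  have hs : ContinuousOn z.s (Icc 0 b) := hz.s_cont.mono fun r hr =>
    ⟨hr.1, lt_of_le_of_lt (EReal.coe_le_coe_iff.2 hr.2) hbE⟩
  have hM : ContinuousOn (fun r => ∫ x in (0 : ℝ)..(z.s r), (z.T x r - P.Tm)) (Icc 0 b) := by
    simp only [integral_eq_scaled]
    exact continuousOn_parametric_intervalIntegral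
      (v := fun y r => z.s r * (z.T (z.s r * y) r - P.Tm)) hb (hz.continuousOn_scaled le_rfl hbE)
  exact ((continuousOn_const.mul hM).add
    (continuousOn_const.mul (hs.sub continuousOn_const))).neg

theorem h₁_zero (hz : IsClassicalSolution P D z E) (hD : 0 ≤ D.s₀) :
    h₁ P z 0 = D.sigma P := by
  have : ∫ x in (0 : ℝ)..D.s₀, (z.T x 0 - P.Tm) = ∫ x in (0 : ℝ)..D.s₀, (D.T₀ x - P.Tm) :=
    intervalIntegral.integral_congr_ae <| Eventually.of_forall fun x hx => by
      rw [uIoc_of_le hD] at hx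
      rw [hz.T_init x hx]
  simp only [h₁, InitialData.sigma, hz.s_init, this]

end IsClassicalSolution

/-! ### Minimum principle -/

theorem hasDerivAt_nonpos_of_le_left {f : ℝ → ℝ} {f' t : ℝ} (hf : HasDerivAt f f' t)
    (hmin : ∀ᶠ r in 𝓝[<] t, f t ≤ f r) : f' ≤ 0 := by
  refine le_of_tendsto ((hasDerivWithinAt_iff_tendsto_slope' (s := Iio t) self_notMem_Iio).1
    hf.hasDerivWithinAt) ?_
  filter_upwards [hmin, self_mem_nhdsWithin] with r hr hrt
  rw [slope_def_field]
  exact div_nonpos_of_nonneg_of_nonpos (sub_nonneg.2 hr) (sub_nonpos.2 (le_of_lt hrt))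

theorem hasDerivWithinAt_nonneg_of_le_right {f : ℝ → ℝ} {f' t : ℝ}
    (hf : HasDerivWithinAt f f' (Ioi t) t) (hmin : ∀ᶠ r in 𝓝[>] t, f t ≤ f r) : 0 ≤ f' := by
  refine ge_of_tendsto ((hasDerivWithinAt_iff_tendsto_slope' (s := Ioi t) self_notMem_Ioi).1 hf) ?_
  filter_upwards [hmin, self_mem_nhdsWithin] with r hr hrt
  rw [slope_def_field]
  exact div_nonneg (sub_nonneg.2 hr) (sub_nonneg.2 (le_of_lt hrt))

/-- The necessary second-order condition at a local minimum. -/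
theorem deriv_deriv_nonneg_of_isLocalMin {f : ℝ → ℝ} {x : ℝ} (hmin : IsLocalMin f x)
    (hc : ContinuousAt f x) : 0 ≤ deriv (deriv f) x := by
  -- A negative second derivative would make the point a local maximum too, so `f` would be locally
  -- constant.
  by_contra! hneg
  have hmax := isLocalMax_of_deriv_deriv_neg hneg hmin.deriv_eq_zero hc
  have hconst : f =ᶠ[𝓝 x] fun _ => f x := by
    filter_upwards [hmin, hmax] with y h1 h2 using le_antisymm h2 h1
  have := hconst.deriv.deriv_eq
  simp only [deriv_const'] at this
  linarith

namespace IsClassicalSolution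

variable {P : Plant} {D : InitialData} {z : Trajectory} {E : EReal}

/-- The initial condition is imposed on `(0, s₀]` only; the point `x = 0` is reached by continuity.
-/
theorem le_T_zero (hz : IsClassicalSolution P D z E) (hE : 0 < E) (hs₀ : 0 < D.s₀)
    (hT₀ : ∀ x ∈ Icc 0 D.s₀, P.Tm ≤ D.T₀ x) : ∀ x ∈ Icc 0 D.s₀, P.Tm ≤ z.T x 0 := by
  have hc : ContinuousOn (fun x => z.T x 0) (Icc 0 D.s₀) :=
    hz.T_cont.comp (f := fun x : ℝ => (x, (0 : ℝ))) (by fun_prop)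
      (fun x hx => ⟨le_rfl, by simpa using hE, hx.1, by simpa [hz.s_init] using hx.2⟩)
  have hcl : closure (Ioc 0 D.s₀) = Icc 0 D.s₀ := closure_Ioc hs₀.ne
  rw [← hcl] at hc ⊢
  exact fun x hx => le_on_closure (f := fun _ => P.Tm) (g := fun x => z.T x 0)
    (fun y hy => by
      simp only [hz.T_init y hy]
      exact hT₀ y (Ioc_subset_Icc_self hy)) continuousOn_const hc hx

/-- Minimum principle: the liquid does not cool below the melting temperature as long as heat
is not extracted at the fixed boundary. -/
theorem le_T_of_flux_nonneg (hz : IsClassicalSolution P D z E) (hα : 0 < P.α) (hk : 0 < P.k)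
    (hs₀ : 0 < D.s₀) (hT₀ : ∀ x ∈ Icc 0 D.s₀, P.Tm ≤ D.T₀ x) {t₁ : ℝ} (ht₁ : 0 ≤ t₁)
    (ht₁E : (t₁ : EReal) < E) (hq : ∀ t ∈ Ioc 0 t₁, 0 ≤ z.q t) {x₁ : ℝ}
    (hx₁ : x₁ ∈ Icc 0 (z.s t₁)) : P.Tm ≤ z.T x₁ t₁ := by
  by_contra! hneg
  have hE : ∀ r ∈ Icc 0 t₁, (r : EReal) < E := fun r hr =>
    lt_of_le_of_lt (EReal.coe_le_coe_iff.2 hr.2) ht₁E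
  have hs : ContinuousOn z.s (Icc 0 t₁) := hz.s_cont.mono fun r hr => ⟨hr.1, hE r hr⟩
  have hspos : ∀ r ∈ Icc 0 t₁, 0 < z.s r := fun r hr => hz.s_pos r hr.1 (hE r hr)
  obtain ⟨B, hB⟩ := isCompact_Icc.exists_bound_of_continuousOn hs
  have hsB : ∀ r ∈ Icc 0 t₁, z.s r ≤ B := fun r hr => (le_abs_self _).trans (hB r hr)
  have hBpos : 0 < B := (hspos t₁ ⟨ht₁, le_rfl⟩).trans_le (hsB t₁ ⟨ht₁, le_rfl⟩)
  set ε := (P.Tm - z.T x₁ t₁) / (B + t₁ + 1) with hεdef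
  have hε : 0 < ε := div_pos (by linarith) (by linarith)
  -- The term `ε t` makes the heat inequality strict, `-ε x` does so for the flux at `x = 0`, and `B
  -- ≥ s` keeps the correction nonnegative, so `v < 0` forces `T < Tm`. The size of `ε` keeps `v`
  -- negative at `(x₁, t₁)`.
  set v : ℝ → ℝ → ℝ := fun x t => z.T x t - P.Tm + ε * (B - x + t) with hv
  have hφ : ContinuousOn (fun p : ℝ × ℝ => (z.s p.2 * p.1, p.2)) (Icc 0 1 ×ˢ Icc 0 t₁) :=
    ((hs.comp (f := fun p : ℝ × ℝ => p.2) (by fun_prop) (fun p hp => hp.2)).mul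
      continuousOn_fst).prodMk continuousOn_snd
  have hvc : ContinuousOn (fun p : ℝ × ℝ => v (z.s p.2 * p.1) p.2) (Icc 0 1 ×ˢ Icc 0 t₁) := by
    refine ContinuousOn.add (ContinuousOn.sub ?_ continuousOn_const)
      (continuousOn_const.mul ((continuousOn_const.sub (continuousOn_fst.comp hφ
        (mapsTo_univ _ _))).add continuousOn_snd))
    refine hz.T_cont.comp (f := fun p : ℝ × ℝ => (z.s p.2 * p.1, p.2)) hφ (fun p hp => ?_)
    have := hspos p.2 hp.2
    exact ⟨hp.2.1, hE _ hp.2, mul_nonneg this.le hp.1.1, mul_le_of_le_one_right this.le hp.1.2⟩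
  -- The minimum is taken over the rescaled rectangle, which is compact.
  obtain ⟨⟨y, t⟩, ⟨hy, ht⟩, hmin'⟩ := (isCompact_Icc.prod isCompact_Icc).exists_isMinOn
    ⟨((0 : ℝ), (0 : ℝ)), ⟨le_rfl, zero_le_one⟩, ⟨le_rfl, ht₁⟩⟩ hvc
  simp only at hy ht
  have hmin : ∀ r ∈ Icc 0 t₁, ∀ x ∈ Icc 0 (z.s r), v (z.s t * y) t ≤ v x r := by
    intro r hr x hx
    have hsr := hspos r hr
    have := hmin' (show (x / z.s r, r) ∈ Icc 0 1 ×ˢ Icc 0 t₁ from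
      ⟨⟨div_nonneg hx.1 hsr.le, (div_le_one hsr).2 hx.2⟩, hr⟩)
    simpa [mul_div_cancel₀ _ hsr.ne'] using this
  obtain ⟨x, hx, hxy⟩ : ∃ x ∈ Icc 0 (z.s t), z.s t * y = x :=
    ⟨_, ⟨mul_nonneg (hspos t ht).le hy.1, mul_le_of_le_one_right (hspos t ht).le hy.2⟩, rfl⟩
  simp only [hxy] at hmin
  have hvneg : v x t < 0 := by
    refine (hmin t₁ ⟨ht₁, le_rfl⟩ x₁ hx₁).trans_lt ?_
    have h1 : ε * (B - x₁ + t₁) < ε * (B + t₁ + 1) :=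
      mul_lt_mul_of_pos_left (by linarith [hx₁.1]) hε
    have h2 : ε * (B + t₁ + 1) = P.Tm - z.T x₁ t₁ := div_mul_cancel₀ _ (by linarith)
    simp only [hv]
    linarith
  have hcorr : 0 ≤ ε * (B - x + t) :=
    mul_nonneg hε.le (by linarith [hx.2, hsB t ht, ht.1])
  have hTneg : z.T x t < P.Tm := by
    simp only [hv] at hvneg
    linarith
  have ht0 : 0 < t := by
    refine lt_of_le_of_ne ht.1 fun h0 => ?_
    subst h0
    refine absurd (hz.le_T_zero ?_ hs₀ hT₀ x (hz.s_init ▸ hx)) (not_le.2 hTneg)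
    simpa using hE 0 ht
  have hxs : x < z.s t := by
    refine lt_of_le_of_ne hx.2 fun h0 => ?_
    subst h0
    linarith [hz.melt t ht0 (hE t ht)]
  have hTx : HasDerivWithinAt (fun y => z.T y t) (Tx z x t) (Icc 0 (z.s t)) x :=
    (hz.T_diff_x (x, t) ⟨ht0, hE t ht, hx.1, hx.2⟩).hasDerivWithinAt
  have hlin : ∀ y : ℝ, HasDerivAt (fun y => ε * (B - y + t)) (-ε) y := fun y => by
    simpa using (((hasDerivAt_id y).const_sub B).add_const t).const_mul ε
  rcases hx.1.eq_or_lt with h0 | h0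
  · subst h0
    have hd : HasDerivWithinAt (fun y => v y t) (Tx z 0 t + -ε) (Ioi 0) 0 :=
      ((hTx.mono_of_mem_nhdsWithin (Icc_mem_nhdsGT (hspos t ht))).sub_const P.Tm).add
        (hlin 0).hasDerivWithinAt
    have hge := hasDerivWithinAt_nonneg_of_le_right hd (by
      filter_upwards [Ioo_mem_nhdsGT (hspos t ht)] with y hy
      exact hmin t ht y ⟨hy.1.le, hy.2.le⟩)
    have hfl := hz.flux t ht0 (hE t ht)
    have hqt := hq t ⟨ht0, ht.2⟩
    have : 0 < Tx z 0 t := by linarith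
    nlinarith [mul_pos hk this]
  · have hp : (x, t) ∈ openDomain z E := ⟨ht0, hE t ht, h0, hxs⟩
    -- Only earlier times are compared, since `t = t₁` is possible; continuity of `s` keeps `x`
    -- inside the liquid at those times.
    have htime : Tt z x t + ε ≤ 0 := by
      have hd : HasDerivAt (fun r => v x r) (Tt z x t + ε) t := by
        refine ((hz.T_diff_t _ hp).hasDerivAt.sub_const P.Tm).add ?_
        simpa using ((hasDerivAt_id t).const_add (B - x)).const_mul ε
      refine hasDerivAt_nonpos_of_le_left hd ?_
      have hsc := (hz.interface t ht0 (hE t ht)).continuousAt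
      filter_upwards [Ioo_mem_nhdsLT ht0,
        nhdsWithin_le_nhds (hsc.eventually (lt_mem_nhds hxs))] with r hr hxr
      exact hmin r ⟨hr.1.le, hr.2.le.trans ht.2⟩ x ⟨hx.1, hxr.le⟩
    have hspace : 0 ≤ Txx z x t := by
      have hd : ∀ y ∈ Ioo 0 (z.s t), HasDerivAt (fun y => v y t) (Tx z y t + -ε) y := fun y hy =>
        ((hz.hasDerivAt_T_x (p := (y, t)) ⟨ht0, hE t ht, hy.1, hy.2⟩).sub_const P.Tm).add (hlin y)
      have hnh : Ioo 0 (z.s t) ∈ 𝓝 x := Ioo_mem_nhds h0 hxs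
      have heq : deriv (fun y => v y t) =ᶠ[𝓝 x] fun y => Tx z y t + -ε := by
        filter_upwards [hnh] with y hy using (hd y hy).deriv
      have h2 := deriv_deriv_nonneg_of_isLocalMin (f := fun y => v y t) (x := x) (by
        filter_upwards [hnh] with y hy using hmin t ht y ⟨hy.1.le, hy.2.le⟩)
        (hd x ⟨h0, hxs⟩).continuousAt
      rw [heq.deriv_eq, deriv_add_const] at h2
      exact h2
    have hheat := hz.heat _ hp
    simp only at hheat
    nlinarith [mul_nonneg hα.le hspace]

end IsClassicalSolution

/-! ### Dwell-time quadratics and a differential inequality -/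

theorem quadratic_root_pos {e p n : ℝ} (he : 0 < e) (hn : 0 < n) :
    0 < (-p + √(p ^ 2 + 2 * e * n)) / n := by
  refine div_pos ?_ hn
  have : p < √(p ^ 2 + 2 * e * n) := Real.lt_sqrt_of_sq_lt (by nlinarith [mul_pos he hn])
  linarith

/-- Completing the square: `2n (e - p r - n r² / 2) = p² + 2 e n - (n r + p)²`. -/
theorem quadratic_nonneg_of_le_root {e p n r : ℝ} (he : 0 < e) (hp : 0 < p) (hn : 0 < n)
    (hr : 0 ≤ r) (hroot : r ≤ (-p + √(p ^ 2 + 2 * e * n)) / n) :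
    0 ≤ e - p * r - n * r ^ 2 / 2 := by
  rw [le_div_iff₀ hn] at hroot
  have h1 : (r * n + p) ^ 2 ≤ p ^ 2 + 2 * e * n := by
    rw [← Real.sq_sqrt (show 0 ≤ p ^ 2 + 2 * e * n by positivity)]
    exact pow_le_pow_left₀ (by positivity) (by linarith) 2
  have h2 : 0 ≤ n * (e - p * r - n * r ^ 2 / 2) := by nlinarith
  exact nonneg_of_mul_nonneg_right h2 hn

/-- A linear differential inequality preserves the sign. -/
theorem nonneg_of_hasDerivAt_ge {f f' : ℝ → ℝ} {a b c : ℝ} (hab : a ≤ b)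
    (hc : ContinuousOn f (Icc a b)) (hd : ∀ x ∈ Ioo a b, HasDerivAt f (f' x) x)
    (hge : ∀ x ∈ Ioo a b, -c * f x ≤ f' x) (ha : 0 ≤ f a) : 0 ≤ f b := by
  -- Integrating factor `exp (c x)`.
  have hmono : MonotoneOn (fun x => f x * Real.exp (c * x)) (Icc a b) := by
    have hd' : ∀ x ∈ Ioo a b, HasDerivAt (fun x => f x * Real.exp (c * x))
        ((f' x + c * f x) * Real.exp (c * x)) x := fun x hx => by
      have he : HasDerivAt (fun x => Real.exp (c * x)) (Real.exp (c * x) * c) x := by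
        simpa using ((hasDerivAt_id x).const_mul c).exp
      exact ((hd x hx).mul he).congr_deriv (by ring)
    refine monotoneOn_of_deriv_nonneg (convex_Icc a b) (hc.mul (by fun_prop)) ?_ ?_
    · rw [interior_Icc]
      exact fun x hx => (hd' x hx).differentiableAt.differentiableWithinAt
    · rw [interior_Icc]
      intro x hx
      rw [(hd' x hx).deriv]
      exact mul_nonneg (by linarith [hge x hx]) (Real.exp_pos _).le
  have h1 := hmono ⟨le_rfl, hab⟩ ⟨hab, le_rfl⟩ hab
  have h2 : 0 ≤ f b * Real.exp (c * b) := (mul_nonneg ha (Real.exp_pos _).le).trans h1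
  exact nonneg_of_mul_nonneg_left h2 (Real.exp_pos _)

/-- Positivity conditions on the controller parameters. -/
structure Gains.Admissible (G : Gains) : Prop where
  c₁_pos : 0 < G.c₁
  c₂_pos : 0 < G.c₂
  δ₁_pos : 0 < G.δ₁
  δ₂_pos : 0 < G.δ₂
  δ₂_lt : G.δ₂ < 1

/-- Positivity conditions on the physical constants. -/
structure Plant.Admissible (P : Plant) : Prop where
  α_pos : 0 < P.α
  β_pos : 0 < P.β
  k_pos : 0 < P.k

namespace Gains.Admissible

variable {G : Gains}

theorem mu₁_pos (hG : G.Admissible) : 0 < G.mu₁ :=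
  lt_min (mul_pos hG.δ₁_pos hG.c₁_pos) (mul_pos (sub_pos.2 hG.δ₂_lt) hG.c₂_pos)

theorem cbar₂_pos (hG : G.Admissible) : 0 < G.cbar₂ :=
  mul_pos (by linarith [hG.δ₂_pos]) hG.c₂_pos

theorem tau₁_eq (G : Gains) : G.tau₁ = (-(G.c₁ * (G.mu₁ + G.c₁)) +
    √((G.c₁ * (G.mu₁ + G.c₁)) ^ 2 + 2 * G.mu₁ * ((1 - G.δ₂) * G.c₁ ^ 2 * G.c₂))) /
      ((1 - G.δ₂) * G.c₁ ^ 2 * G.c₂) := by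
  rw [Gains.tau₁]
  congr 4 <;> ring

theorem tau₂_eq (G : Gains) : G.tau₂ = (-(G.c₁ + G.cbar₂) +
    √((G.c₁ + G.cbar₂) ^ 2 + 2 * G.δ₂ * (G.c₁ * G.cbar₂))) / (G.c₁ * G.cbar₂) := by
  rw [Gains.tau₂]
  congr 4
  ring

theorem tau₁_coeff_pos (hG : G.Admissible) : 0 < (1 - G.δ₂) * G.c₁ ^ 2 * G.c₂ :=
  mul_pos (mul_pos (sub_pos.2 hG.δ₂_lt) (pow_pos hG.c₁_pos 2)) hG.c₂_pos

theorem tau_pos (hG : G.Admissible) : 0 < G.tau := by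
  refine lt_min ?_ ?_
  · rw [tau₁_eq]
    exact quadratic_root_pos hG.mu₁_pos hG.tau₁_coeff_pos
  · rw [tau₂_eq]
    exact quadratic_root_pos hG.δ₂_pos (mul_pos hG.c₁_pos hG.cbar₂_pos)

theorem quadratic₁_nonneg (hG : G.Admissible) {r : ℝ} (hr : 0 ≤ r) (hτ : r ≤ G.tau) :
    0 ≤ G.mu₁ - G.c₁ * (G.mu₁ + G.c₁) * r - (1 - G.δ₂) * G.c₁ ^ 2 * G.c₂ * r ^ 2 / 2 :=
  quadratic_nonneg_of_le_root hG.mu₁_pos (mul_pos hG.c₁_pos (add_pos hG.mu₁_pos hG.c₁_pos))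
    hG.tau₁_coeff_pos hr (tau₁_eq G ▸ hτ.trans (min_le_left _ _))

theorem quadratic₂_nonneg (hG : G.Admissible) {r : ℝ} (hr : 0 ≤ r) (hτ : r ≤ G.tau) :
    0 ≤ G.δ₂ - (G.c₁ + G.cbar₂) * r - G.c₁ * G.cbar₂ * r ^ 2 / 2 :=
  quadratic_nonneg_of_le_root hG.δ₂_pos (add_pos hG.c₁_pos hG.cbar₂_pos)
    (mul_pos hG.c₁_pos hG.cbar₂_pos) hr (tau₂_eq G ▸ hτ.trans (min_le_right _ _))

end Gains.Admissible

/-! ### The plant under a held input -/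

/-- The plant driven by the input `U*(a)` held constant from time `a` on. -/
structure IsHeld (P : Plant) (G : Gains) (D : InitialData) (z : Trajectory) (E : EReal) (a : ℝ) :
    Prop where
  sol : IsClassicalSolution P D z E
  start_nonneg : 0 ≤ a
  flux_cont : ContinuousOn z.q {t : ℝ | 0 ≤ t ∧ (t : EReal) < E}
  hold : ∀ t : ℝ, a ≤ t → (t : EReal) < E → HasDerivWithinAt z.q (Ustar P G z a) (Ici t) t

namespace IsHeld

variable {P : Plant} {G : Gains} {D : InitialData} {z : Trajectory} {E : EReal} {a : ℝ}

theorem q_eq (H : IsHeld P G D z E a) {t : ℝ} (hat : a ≤ t) (htE : (t : EReal) < E) :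
    z.q t = z.q a + Ustar P G z a * (t - a) := by
  have hE : ∀ r ∈ Icc a t, (r : EReal) < E := fun r hr =>
    lt_of_le_of_lt (EReal.coe_le_coe_iff.2 hr.2) htE
  refine eq_of_has_deriv_right_eq (f' := fun _ => Ustar P G z a) (a := a) (b := t)
    (g := fun r => z.q a + Ustar P G z a * (r - a))
    (fun r hr => H.hold r hr.1 (hE r (Ico_subset_Icc_self hr))) (fun r _ => ?_)
    (H.flux_cont.mono fun r hr => ⟨H.start_nonneg.trans hr.1, hE r hr⟩) (by fun_prop) (by simp)
    t ⟨hat, le_rfl⟩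
  simpa using ((((hasDerivAt_id r).sub_const a).const_mul (Ustar P G z a)).const_add
    (z.q a)).hasDerivWithinAt

/-- The hold gives right derivatives only; the affine formula upgrades them to two-sided ones after
`a`. -/
theorem hasDerivAt_q (H : IsHeld P G D z E a) {t : ℝ} (hat : a < t) (htE : (t : EReal) < E) :
    HasDerivAt z.q (Ustar P G z a) t := by
  have h1 : HasDerivAt (fun r => z.q a + Ustar P G z a * (r - a)) (Ustar P G z a) t := by
    simpa using (((hasDerivAt_id t).sub_const a).const_mul (Ustar P G z a)).const_add (z.q a)
  refine h1.congr_of_eventuallyEq ?_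
  filter_upwards [lt_mem_nhds hat,
    continuous_coe_real_ereal.continuousAt.eventually (gt_mem_nhds htE)] with r hr hrE
  exact H.q_eq hr.le hrE

theorem continuousOn_q (H : IsHeld P G D z E a) {b : ℝ} (hbE : (b : EReal) < E) :
    ContinuousOn z.q (Icc a b) :=
  H.flux_cont.mono fun _ hr => ⟨H.start_nonneg.trans hr.1,
    lt_of_le_of_lt (EReal.coe_le_coe_iff.2 hr.2) hbE⟩

theorem continuousOn_h₁ (H : IsHeld P G D z E a) {b : ℝ} (hab : a ≤ b) (hbE : (b : EReal) < E) :
    ContinuousOn (h₁ P z) (Icc a b) :=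
  (H.sol.continuousOn_h₁ (H.start_nonneg.trans hab) hbE).mono (Icc_subset_Icc_left H.start_nonneg)

theorem h₁_eq (H : IsHeld P G D z E a) (hP : P.Admissible) {t : ℝ} (hat : a ≤ t)
    (htE : (t : EReal) < E) :
    h₁ P z t = h₁ P z a - z.q a * (t - a) - Ustar P G z a * (t - a) ^ 2 / 2 := by
  rcases hat.eq_or_lt with rfl | hat'
  · simp
  -- The function added up here has derivative zero by `q_eq`, so the mean value theorem equates its
  -- values at `a` and `t`.
  obtain ⟨c, hc, hslope⟩ := exists_hasDerivAt_eq_slope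
    (fun r => h₁ P z r + z.q a * (r - a) + Ustar P G z a * (r - a) ^ 2 / 2)
    (fun r => -z.q r + z.q a + Ustar P G z a * (r - a)) hat'
    (((H.continuousOn_h₁ hat htE).add (by fun_prop)).add (by fun_prop)) (fun r hr => by
      have h1 := H.sol.hasDerivAt_h₁ hP.α_pos hP.β_pos hP.k_pos
        (H.start_nonneg.trans_lt hr.1) (lt_trans (EReal.coe_lt_coe_iff.2 hr.2) htE)
      have h2 := (hasDerivAt_id r).sub_const a
      exact ((h1.add (h2.const_mul (z.q a))).add
        (((h2.pow 2).const_mul (Ustar P G z a)).div_const 2)).congr_deriv (by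
          simp only [id]; ring))
  rw [H.q_eq hc.1.le (lt_trans (EReal.coe_lt_coe_iff.2 hc.2) htE),
    eq_div_iff (sub_pos.2 hat').ne'] at hslope
  simp only [sub_self] at hslope
  linarith

/-- No event occurs before the dwell time has elapsed. -/
theorem not_violates (H : IsHeld P G D z E a) (hP : P.Admissible) (hG : G.Admissible)
    (h2 : 0 ≤ h₂ z a) (h3 : 0 ≤ h₃ P G z a) {t : ℝ} (hat : a ≤ t) (htE : (t : EReal) < E)
    (hτ : t ≤ a + G.tau) : ¬ Violates P G z a t := by
  have hr : 0 ≤ t - a := sub_nonneg.2 hat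
  have hrτ : t - a ≤ G.tau := by linarith
  have hq1 := hG.quadratic₁_nonneg hr hrτ
  have hq2 := hG.quadratic₂_nonneg hr hrτ
  have hq := H.q_eq hat htE
  have hσ := H.h₁_eq hP hat htE
  have c1 := hG.c₁_pos
  have c2 := hG.c₂_pos
  have d2 := hG.δ₂_pos
  have d2' := sub_pos.2 hG.δ₂_lt
  have mu := hG.mu₁_pos
  simp only [Violates, not_or, not_lt]
  simp only [Ustar, h₂, h₃, Gains.cbar₂] at *
  rw [hq, hσ]
  -- With `A = q(a)` and `B = h₃(a)` as coordinates, `h₁(a) = (A + B) / c₁`.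
  obtain ⟨B, hB⟩ : ∃ B, B = -z.q a + G.c₁ * h₁ P z a := ⟨_, rfl⟩
  clear hq hσ hτ
  generalize t - a = r at *
  rw [← hB] at h3
  generalize z.q a = A at *
  have hS' : h₁ P z a = (A + B) / G.c₁ := by
    rw [hB]; field_simp; ring
  rw [hS']
  have e : G.c₁ * ((A + B) / G.c₁) = A + B := mul_div_cancel₀ _ c1.ne'
  have e' : ∀ x y : ℝ, G.c₁ * ((A + B) / G.c₁ - x - y) = A + B - G.c₁ * x - G.c₁ * y := by
    intro x y; rw [mul_sub, mul_sub, e]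
  rw [e, e']
  constructor
  -- Here the `τ₂` quadratic multiplies `c₂ B`; in the second inequality the `τ₁` quadratic
  -- multiplies `A`.
  · have k1 : 0 ≤ A * (G.c₁ ^ 2 * r + G.c₂ * G.c₁ ^ 2 * r ^ 2 / 2 +
        G.δ₂ * G.c₂ * G.c₁ ^ 2 * r ^ 2 / 2) := by positivity
    have k2 := mul_nonneg h3 (mul_nonneg c2.le hq2)
    rw [← sub_nonneg]
    refine (add_nonneg k1 k2).trans_eq ?_
    ring
  · have k1 := mul_nonneg h2 hq1
    have k2 : 0 ≤ B * (G.mu₁ * G.c₂ * r + G.δ₂ * G.c₂ + G.c₁ * G.c₂ * r +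
        (1 - G.δ₂) * (G.c₂ ^ 2 * r + G.c₁ * G.c₂ ^ 2 * r ^ 2 / 2)) :=
      mul_nonneg h3 (add_nonneg (by positivity) (mul_nonneg d2'.le (by positivity)))
    rw [← sub_nonneg]
    refine (add_nonneg k1 k2).trans_eq ?_
    ring

/-- The barrier functions stay nonnegative until the next event. -/
theorem barrier_nonneg (H : IsHeld P G D z E a) (hP : P.Admissible) (hG : G.Admissible)
    (h2 : 0 ≤ h₂ z a) (h3 : 0 ≤ h₃ P G z a) {b : ℝ} (hab : a ≤ b) (hbE : (b : EReal) < E)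
    (hnv : ∀ t ∈ Ioo a b, ¬ Violates P G z a t) : 0 ≤ h₂ z b ∧ 0 ≤ h₃ P G z b := by
  have hE : ∀ r, r ≤ b → (r : EReal) < E := fun r hr =>
    lt_of_le_of_lt (EReal.coe_le_coe_iff.2 hr) hbE
  -- With `Ũ = U*(r) - U*(a)`, one has `h₃' = -c₂ h₃ + Ũ`, and the first trigger inequality bounds
  -- `Ũ` below by `-δ₂ c₂ h₃`.
  have key : ∀ t ∈ Icc a b, 0 ≤ h₃ P G z t := fun t ht => by
    refine nonneg_of_hasDerivAt_ge (f := h₃ P G z) (c := (1 + G.δ₂) * G.c₂)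
      (f' := fun r => -Ustar P G z a + G.c₁ * -z.q r) ht.1
      ((H.continuousOn_q (hE t ht.2)).neg.add
        (continuousOn_const.mul (H.continuousOn_h₁ ht.1 (hE t ht.2))))
      (fun r hr => ?_) (fun r hr => ?_) h3
    · have hrE := hE r (hr.2.le.trans ht.2)
      exact (H.hasDerivAt_q hr.1 hrE).neg.add ((H.sol.hasDerivAt_h₁ hP.α_pos hP.β_pos hP.k_pos
        (H.start_nonneg.trans_lt hr.1) hrE).const_mul G.c₁)
    · have hv := hnv r ⟨hr.1, hr.2.trans_le ht.2⟩
      simp only [Violates, not_or, not_lt] at hv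
      have hU : Ustar P G z r = -G.c₁ * z.q r + G.c₂ * h₃ P G z r := rfl
      linarith [hv.1]
  refine ⟨?_, key b ⟨hab, le_rfl⟩⟩
  -- The second trigger inequality gives `q' ≥ -(c₁ + μ₁) q + (1 - δ₂) c₂ h₃`, whose last term is
  -- nonnegative by `key`.
  refine nonneg_of_hasDerivAt_ge (f := z.q) (c := G.c₁ + G.mu₁)
    (f' := fun _ => Ustar P G z a) hab (H.continuousOn_q hbE)
    (fun r hr => H.hasDerivAt_q hr.1 (hE r hr.2.le)) (fun r hr => ?_) h2
  have hv := hnv r hr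
  simp only [Violates, not_or, not_lt] at hv
  have hU : Ustar P G z r = -G.c₁ * z.q r + G.c₂ * h₃ P G z r := rfl
  have hq : h₂ z r = z.q r := rfl
  have hpos : 0 ≤ (1 - G.δ₂) * G.c₂ * h₃ P G z r :=
    mul_nonneg (mul_nonneg (sub_pos.2 hG.δ₂_lt).le hG.c₂_pos.le) (key r (Ioo_subset_Icc_self hr))
  rw [hq] at hv
  linarith [hv.2]

end IsHeld

/-! ### Induction over the events -/

theorem h₁_congr {P : Plant} {z z' : Trajectory} {t : ℝ} (hs0 : 0 ≤ z.s t)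
    (hs : z'.s t = z.s t) (hT : ∀ x ∈ Icc 0 (z.s t), z'.T x t = z.T x t) :
    h₁ P z' t = h₁ P z t := by
  have : ∫ x in (0 : ℝ)..(z.s t), (z'.T x t - P.Tm) = ∫ x in (0 : ℝ)..(z.s t), (z.T x t - P.Tm) :=
    intervalIntegral.integral_congr fun x hx => by
      rw [uIcc_of_le hs0] at hx
      simp only [hT x hx]
  simp only [h₁, hs, this]

namespace IsClosedLoop

variable {P : Plant} {G : Gains} {D : InitialData} {e : Execution}

/-- The state reached at the `j`-th event time, if there is a `j`-th event: the barrier functions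
are nonnegative there, and the boundary flux has been nonnegative up to that time. -/
def SafeAt (P : Plant) (G : Gains) (e : Execution) (j : ℕ) : Prop :=
  0 ≤ e.time j ∧ ∀ a : ℝ, e.time j = a →
    0 ≤ h₂ (e.traj j) a ∧ 0 ≤ h₃ P G (e.traj j) a ∧ ∀ r ∈ Icc 0 a, 0 ≤ (e.traj j).q r

theorem isHeld (he : IsClosedLoop P G D e) {j : ℕ} {a : ℝ} (hj : e.time j = a) (ha : 0 ≤ a) :
    IsHeld P G D (e.traj j) (e.life j) a := by
  have hne : e.time j ≠ ⊤ := hj ▸ EReal.coe_ne_top a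
  refine ⟨he.plant j hne, ha, he.flux_cont j hne, fun t hat htE => ?_⟩
  have := he.hold j t (hj ▸ EReal.coe_le_coe_iff.2 hat) htE
  rwa [hj, EReal.toReal_coe] at this

theorem not_violates (he : IsClosedLoop P G D e) {j : ℕ} {a : ℝ} (hj : e.time j = a) {t : ℝ}
    (hat : a < t) (htE : (t : EReal) < e.life j) (ht : (t : EReal) < e.time (j + 1)) :
    ¬ Violates P G (e.traj j) a t := fun hv => by
  refine absurd ht (not_lt.2 ?_)
  rw [he.trigger j]
  exact sInf_le ⟨t, ⟨hj ▸ EReal.coe_lt_coe_iff.2 hat, htE, by rwa [hj, EReal.toReal_coe]⟩, rfl⟩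

theorem barrier_nonneg (he : IsClosedLoop P G D e) (hP : P.Admissible) (hG : G.Admissible)
    {j : ℕ} (hsafe : SafeAt P G e j) {a : ℝ} (hj : e.time j = a) {b : ℝ} (hab : a ≤ b)
    (hb : (b : EReal) ≤ e.time (j + 1)) (hbE : (b : EReal) < e.life j) :
    0 ≤ h₂ (e.traj j) b ∧ 0 ≤ h₃ P G (e.traj j) b := by
  have ha : 0 ≤ a := by simpa [hj] using hsafe.1
  obtain ⟨h2, h3, -⟩ := hsafe.2 a hj
  refine (he.isHeld hj ha).barrier_nonneg hP hG h2 h3 hab hbE fun t ht => ?_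
  have htb : (t : EReal) < b := EReal.coe_lt_coe_iff.2 ht.2
  exact he.not_violates hj ht.1 (htb.trans hbE) (htb.trans_le hb)

/-- The minimum principle needs the sign of the flux from time `0` on, hence the history carried in
`SafeAt`. -/
theorem flux_nonneg (he : IsClosedLoop P G D e) (hP : P.Admissible) (hG : G.Admissible)
    {j : ℕ} (hsafe : SafeAt P G e j) {a : ℝ} (hj : e.time j = a) {b : ℝ}
    (hb : (b : EReal) ≤ e.time (j + 1)) (hbE : (b : EReal) < e.life j) {r : ℝ}
    (hr : r ∈ Icc 0 b) : 0 ≤ (e.traj j).q r := by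
  rcases le_total r a with h | h
  · exact (hsafe.2 a hj).2.2 r ⟨hr.1, h⟩
  · have hrb : (r : EReal) ≤ b := EReal.coe_le_coe_iff.2 hr.2
    exact (he.barrier_nonneg hP hG hsafe hj h (hrb.trans hb) (hrb.trans_lt hbE)).1

theorem time_succ_of_eq_top (he : IsClosedLoop P G D e) {j : ℕ} (hj : e.time j = ⊤) :
    e.time (j + 1) = ⊤ := by
  rw [he.trigger j, hj]
  simp

theorem dwell_of_safeAt (he : IsClosedLoop P G D e) (hP : P.Admissible) (hG : G.Admissible)
    {j : ℕ} (hsafe : SafeAt P G e j) : e.time j + (G.tau : EReal) ≤ e.time (j + 1) := by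
  induction h : e.time j with
  | bot => simp
  | top => simp [he.time_succ_of_eq_top h]
  | coe a =>
    have ha : 0 ≤ a := by simpa [h] using hsafe.1
    obtain ⟨h2, h3, -⟩ := hsafe.2 a h
    rw [he.trigger j]
    refine le_sInf ?_
    rintro _ ⟨t, ⟨hat, htE, hv⟩, rfl⟩
    rw [h, EReal.coe_lt_coe_iff] at hat
    rw [h, EReal.toReal_coe] at hv
    rw [← EReal.coe_add, EReal.coe_le_coe_iff]
    by_contra! hlt
    exact (he.isHeld h ha).not_violates hP hG h2 h3 hat.le htE hlt.le hv

/-- A finite event time is an infimum of a nonempty set of times before the end of life, so the old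
trajectory still exists there and can hand over its state. -/
theorem time_succ_lt_life (he : IsClosedLoop P G D e) {j : ℕ} (h : e.time (j + 1) ≠ ⊤) :
    e.time (j + 1) < e.life j := by
  rw [he.trigger j] at h ⊢
  obtain ⟨_, ⟨t, ht, rfl⟩, -⟩ := sInf_lt_iff.1 (lt_top_iff_ne_top.2 h)
  exact (sInf_le (mem_image_of_mem _ ht)).trans_lt ht.2.1

theorem safeAt_succ (he : IsClosedLoop P G D e) (hP : P.Admissible) (hG : G.Admissible)
    {j : ℕ} (hsafe : SafeAt P G e j) : SafeAt P G e (j + 1) := by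
  have hdw := he.dwell_of_safeAt hP hG hsafe
  have hτ : (0 : EReal) ≤ (G.tau : EReal) := EReal.coe_nonneg.2 hG.tau_pos.le
  have hle : e.time j ≤ e.time (j + 1) := le_trans (by simpa using add_le_add_right hτ (e.time j)) hdw
  refine ⟨hsafe.1.trans hle, fun b hb => ?_⟩
  have hbtop : e.time (j + 1) ≠ ⊤ := hb ▸ EReal.coe_ne_top b
  have hbE : (b : EReal) < e.life j := hb ▸ he.time_succ_lt_life hbtop
  induction h : e.time j with
  | bot => simpa [h] using hsafe.1
  | top => exact absurd (he.time_succ_of_eq_top h) hbtop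
  | coe a =>
    have ha : 0 ≤ a := by simpa [h] using hsafe.1
    have hab : a ≤ b := by simpa [h, hb] using hle
    obtain ⟨h2, h3⟩ := he.barrier_nonneg hP hG hsafe h hab hb.ge hbE
    have hpast := he.same_past j hbtop
    have hbb := hpast b (ha.trans hab) hb.ge
    have hs0 := ((he.isHeld h ha).sol.s_pos b (ha.trans hab) hbE).le
    refine ⟨?_, ?_, fun r hr => ?_⟩
    · simpa only [h₂, hbb.2.1] using h2
    · simpa only [h₃, hbb.2.1, h₁_congr hs0 hbb.1 hbb.2.2] using h3
    · rw [(hpast r hr.1 (hb ▸ EReal.coe_le_coe_iff.2 hr.2)).2.1]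
      exact he.flux_nonneg hP hG hsafe h hb.ge hbE hr

theorem safeAt_zero (he : IsClosedLoop P G D e) (hs₀ : 0 < D.s₀) (hq₀ : 0 ≤ D.q₀)
    (hgain : D.q₀ ≤ G.c₁ * D.sigma P) : SafeAt P G e 0 := by
  refine ⟨he.time_zero.ge, fun a ha => ?_⟩
  obtain rfl : a = 0 := by
    rw [he.time_zero] at ha
    exact_mod_cast ha.symm
  have hsol := he.plant 0 (by simp [he.time_zero])
  refine ⟨?_, ?_, fun r hr => ?_⟩
  · simpa only [h₂, he.flux_init] using hq₀
  · simp only [h₃, he.flux_init, hsol.h₁_zero hs₀.le]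
    linarith
  · obtain rfl : r = 0 := le_antisymm hr.2 hr.1
    rwa [he.flux_init]

end IsClosedLoop

/-! ### Absence of Zeno behavior and conclusion -/

/-- Event times separated by a positive dwell time exceed every bound. -/
theorem Execution.mul_le_time {e : Execution} {τ : ℝ} (h0 : e.time 0 = 0)
    (hdw : ∀ j, e.time j + (τ : EReal) ≤ e.time (j + 1)) (n : ℕ) :
    ((n * τ : ℝ) : EReal) ≤ e.time n := by
  induction n with
  | zero => simp [h0]
  | succ n ih =>
    refine le_trans ?_ (hdw n)
    rw [show ((n + 1 : ℕ) * τ : ℝ) = n * τ + τ by push_cast; ring, EReal.coe_add]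
    exact add_le_add ih le_rfl

end StefanETC

theorem mainTheorem1 (P : StefanETC.Plant) (G : StefanETC.Gains)
    (hα : 0 < P.α) (hβ : 0 < P.β) (hk : 0 < P.k)
    (hc₁ : 0 < G.c₁) (hc₂ : 0 < G.c₂) (hδ₁ : 0 < G.δ₁) (hδ₂ : 0 < G.δ₂) (hδ₂' : G.δ₂ < 1) :
    0 < G.tau ∧
    ∀ D : StefanETC.InitialData, D.ProfileOK P → 0 ≤ D.q₀ → D.SetpointOK P →
      D.q₀ ≤ G.c₁ * D.sigma P →
      ∀ e : StefanETC.Execution, StefanETC.IsClosedLoop P G D e →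
        (∀ j, e.time j + (G.tau : EReal) ≤ e.time (j + 1)) ∧
        (∀ R : ℝ, {j : ℕ | e.time j ≤ (R : EReal)}.Finite) ∧
        (∀ t : ℝ, 0 ≤ t → (∃! j, e.Active j t) ∧
          ∀ j, e.Active j t → (t : EReal) < e.life j →
            0 ≤ StefanETC.h₁ P (e.traj j) t ∧ 0 ≤ StefanETC.h₂ (e.traj j) t ∧
            ∀ x ∈ Set.Ioo 0 ((e.traj j).s t), 0 ≤ StefanETC.h P (e.traj j) x t) := by
  have hP : P.Admissible := ⟨hα, hβ, hk⟩
  have hG : G.Admissible := ⟨hc₁, hc₂, hδ₁, hδ₂, hδ₂'⟩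
  refine ⟨hG.tau_pos, fun D hprof hq₀ _ hgain e he => ?_⟩
  have hsafe : ∀ j, StefanETC.IsClosedLoop.SafeAt P G e j := fun j => by
    induction j with
    | zero => exact he.safeAt_zero hprof.1 hq₀ hgain
    | succ j ih => exact he.safeAt_succ hP hG ih
  have hdw : ∀ j, e.time j + (G.tau : EReal) ≤ e.time (j + 1) := fun j =>
    he.dwell_of_safeAt hP hG (hsafe j)
  have hτ : (0 : EReal) ≤ (G.tau : EReal) := EReal.coe_nonneg.2 hG.tau_pos.le
  have hmono : Monotone e.time := monotone_nat_of_le_succ fun j =>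
    le_trans (by simpa using add_le_add_right hτ (e.time j)) (hdw j)
  have hlarge : ∀ R : ℝ, ∃ n, (R : EReal) < e.time n := fun R => by
    obtain ⟨n, hn⟩ := exists_nat_gt (R / G.tau)
    refine ⟨n, lt_of_lt_of_le ?_ (StefanETC.Execution.mul_le_time he.time_zero hdw n)⟩
    rw [EReal.coe_lt_coe_iff]
    exact (div_lt_iff₀ hG.tau_pos).1 hn
  refine ⟨hdw, fun R => ?_, fun t ht => ⟨?_, fun j hact hlife => ?_⟩⟩
  · obtain ⟨n, hn⟩ := hlarge R
    refine (Set.finite_lt_nat n).subset fun j hj => ?_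
    by_contra hnj
    exact absurd (hn.trans_le (hmono (not_lt.1 hnj))) (not_lt.2 hj)
  · classical
    have hex := hlarge t
    -- The active index precedes the first `n` with `t < t_n`; that `n` is not `0` because `t₀ = 0 ≤
    -- t`.
    obtain ⟨j, hj⟩ : ∃ j, Nat.find hex = j + 1 := Nat.exists_eq_succ_of_ne_zero fun h0 => by
      have := Nat.find_spec hex
      rw [h0, he.time_zero] at this
      exact absurd this (not_lt.2 (by exact_mod_cast ht))
    refine ⟨j, ⟨not_lt.1 (Nat.find_min hex (by omega)), hj ▸ Nat.find_spec hex⟩, ?_⟩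
    intro i hi
    have h1 : i + 1 ≥ Nat.find hex := Nat.find_min' hex hi.2
    have h2 : i < Nat.find hex := by
      by_contra hcon
      exact absurd ((Nat.find_spec hex).trans_le (hmono (not_lt.1 hcon))) (not_lt.2 hi.1)
    omega
  · obtain ⟨a, ha⟩ : ∃ a : ℝ, e.time j = a := by
      have h1 : e.time j ≠ ⊤ := (hact.1.trans_lt (EReal.coe_lt_top t)).ne
      have h2 : e.time j ≠ ⊥ := fun h => by simpa [h] using (hsafe j).1
      exact ⟨_, (EReal.coe_toReal h1 h2).symm⟩
    have ha0 : 0 ≤ a := by simpa [ha] using (hsafe j).1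
    have hat : a ≤ t := by simpa [ha] using hact.1
    obtain ⟨h2, h3⟩ := he.barrier_nonneg hP hG (hsafe j) ha hat hact.2.le hlife
    refine ⟨?_, h2, fun x hx => sub_nonneg.2 ?_⟩
    -- `c₁ h₁ = h₂ + h₃`.
    · refine nonneg_of_mul_nonneg_right (a := G.c₁) ?_ hc₁
      simp only [StefanETC.h₂, StefanETC.h₃] at h2 h3
      linarith
    · exact (he.isHeld ha ha0).sol.le_T_of_flux_nonneg hα hk hprof.1 hprof.2.2.2.1 ht hlife
        (fun r hr => he.flux_nonneg hP hG (hsafe j) ha hact.2.le hlife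
          (Set.Ioc_subset_Icc_self hr)) (Set.Ioo_subset_Icc_self hx)
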